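/- Let $n\ge 1$, $\mathbb H=\{(x,t):x\in\mathbb R^n,\ t>0\}\subset\mathbb R^{n+1}$, and for $w=(y,s)\in\mathbb H$ put $\overline w=(y,-s)$. For $\lambda\in\mathbb R$ let $dm_\lambda(y,s)=s^\lambda\,dy\,ds$ on $\mathbb H$. Let $\{\Delta_k\}_{k=1}^\infty$ be a Whitney decomposition of $\mathbb H$: nondegenerate closed cubes in $\mathbb H$ with sides parallel to the coordinate axes and pairwise disjoint interiors, such that $\bigcup_k\Delta_k=\mathbb H$, $\operatorname{diam}\Delta_k\asymp\operatorname{dist}(\Delta_k,\partial\mathbb H)$ with constants independent of $k$, and, if $\Delta_k^\ast$ denotes the cube with the same center as $\Delta_k$ enlarged $5/4$ times, $\sum_k\chi_{\Delta_k^\ast}\le C$ on $\mathbb H$ for some constant $C$. Let $(\xi_k,\eta_k)$, with $\xi_k\in\mathbb R^n$ and $\eta_k>0$, be the center of $\Delta_k$. Let $0<p<q<\infty$, $\alpha>0$, and let $\mu$ be a positive Borel measure on $\mathbb H$. Then the following two conditions are equivalent: $1^\circ$. (with $z=(x,t)$ in the inner integral) $$\int_{\mathbb H}\left(\int_{\mathbb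 H}\left(\frac{t^n}{|z-\overline w|^{2n}}\right)^{1+\alpha q}d\mu(z)\right)^{\frac{q}{q-p}}dm_{\alpha qn-1}(w)<\infty;$$ $2^\circ$. $$\sum_{k=1}^\infty\eta_k^{-(\alpha qn+n)\frac{p}{q-p}}\,\mu(\Delta_k)^{\frac{q}{q-p}}<\infty.$$ -/

import Mathlib

open MeasureTheory Set

open scoped ENNReal

noncomputable section

namespace HalfSpace

/-- Points of `ℝ^{n+1} = ℝⁿ × ℝ`, with the Euclidean norm; the last coordinate is the vertical
variable `t`. -/
abbrev Pt (n : ℕ) : Type := EuclideanSpace ℝ (Fin (n + 1))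

/-- The vertical coordinate `t` of `z = (x, t)`. -/
def height {n : ℕ} (z : Pt n) : ℝ := z (Fin.last n)

/-- The upper half space `ℍ = {(x, t) : x ∈ ℝⁿ, t > 0}`. -/
def upperHalf (n : ℕ) : Set (Pt n) := {z | 0 < height z}

/-- The reflection `(x, t) ↦ (x, -t)`. -/
def reflect {n : ℕ} (z : Pt n) : Pt n :=
  WithLp.toLp 2 (Function.update (fun i => z i) (Fin.last n) (-height z))

/-- The measure `dm_lam = t ^ lam dx dt` on the upper half space. -/
def weightedVolume (n : ℕ) (lam : ℝ) : Measure (Pt n) :=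
  ((volume : Measure (Pt n)).restrict (upperHalf n)).withDensity
    (fun z => ENNReal.ofReal (height z ^ lam))

/-- The function `t ^ n / |z - w̄| ^ (2 n)` of `z = (x, t)` and `w`. -/
def kernel {n : ℕ} (z w : Pt n) : ℝ := height z ^ n / ‖z - reflect w‖ ^ (2 * n)

/-- The closed cube with sides parallel to the coordinate axes, center `c` and side `2 r`. -/
def cube {n : ℕ} (c : Pt n) (r : ℝ) : Set (Pt n) := {z | ∀ i, |z i - c i| ≤ r}

/-- The Euclidean distance between two sets. -/
def setDist {n : ℕ} (A B : Set (Pt n)) : ℝ := sInf (Set.image2 dist A B)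

/-- The cubes `Δ k = cube (c k) (r k)` form a Whitney decomposition of the upper half space. -/
structure IsWhitney {n : ℕ} (c : ℕ → Pt n) (r : ℕ → ℝ) : Prop where
  /-- The cubes are nondegenerate. -/
  pos : ∀ k, 0 < r k
  /-- The cubes lie in the upper half space and cover it. -/
  iUnion_eq : ⋃ k, cube (c k) (r k) = upperHalf n
  /-- Diameters are comparable to distances from the boundary of the half space. -/
  diam_comparable : ∃ a b : ℝ, 0 < a ∧ 0 < b ∧ ∀ k,
    a * Metric.diam (cube (c k) (r k)) ≤ setDist (cube (c k) (r k)) (frontier (upperHalf n)) ∧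
    setDist (cube (c k) (r k)) (frontier (upperHalf n)) ≤ b * Metric.diam (cube (c k) (r k))
  /-- The interiors are pairwise disjoint. -/
  disjoint_interior : Pairwise fun j k =>
    Disjoint (interior (cube (c j) (r j))) (interior (cube (c k) (r k)))
  /-- The concentric cubes, enlarged `5 / 4` times, overlap finitely in the upper half space. -/
  finite_overlap : ∃ N : ℕ, ∀ z ∈ upperHalf n,
    {k | z ∈ cube (c k) (5 / 4 * r k)}.encard ≤ N

end HalfSpace

end

namespace HalfSpace

/-! Put κ = 1 + αq, N = nκ = αqn + n and s = q/(q-p) > 1. Then p/(q-p) = s - 1, the outer measure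
has weight exponent N - n - 1, and the kernel to the power κ is t^N |z - w̄|^(-2N). Write η_k for
the height of the center c_k and μ_k for the mass of the k-th cube. Each condition bounds the other
up to a constant factor.

On a Whitney cube the side, the height and, for each fixed w, the distance |z - w̄| are constant up
to bounded factors (`IsWhitney.exists_comparable`). For 1° ⇒ 2°, keep only pairs z, w in the same
cube: there the kernel power is at least a constant times η_k^(-N), and the cube has weighted volume
about η_k^N. This gives η_k^N (η_k^(-N) μ_k)^s = η_k^(-N(s-1)) μ_k^s.

For 2° ⇒ 1°, the inner integral is at most a constant times ∑ η_k^N |c_k - w̄|^(-2N) μ_k. Hölder's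
inequality with an auxiliary power δ, as in Schur's test, moves the exponent s onto the μ_k
(`IsWhitney.rpow_tsum_center_le`); integrating termwise in w then gives the sum in 2°. Both the
Hölder weight and this last integral are controlled by the single estimate
`lintegral_height_rpow_mul_norm_rpow_le`. -/

/-! ### Integrals of powers of the height and of the distance to a reflected point -/

theorem lintegral_pi_prod (n : ℕ) (f : Fin n → ℝ → ℝ≥0∞) (hf : ∀ i, Measurable (f i)) :
    ∫⁻ x : Fin n → ℝ, ∏ i, f i (x i) = ∏ i, ∫⁻ t, f i t := by
  induction n with
  | zero => simp [volume_pi]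
  | succ n ih =>
    have hm : Measurable fun x : Fin n → ℝ => ∏ i, f i.succ (x i) :=
      Finset.measurable_prod _ fun i _ => (hf i.succ).comp (measurable_pi_apply i)
    rw [Fin.prod_univ_succ, ← ih (fun i => f i.succ) fun i => hf i.succ,
      ← lintegral_prod_mul (hf 0).aemeasurable hm.aemeasurable, ← Measure.volume_eq_prod,
      ← (volume_preserving_piFinSuccAbove (fun _ : Fin (n + 1) => ℝ) 0).lintegral_comp_emb
        (MeasurableEquiv.measurableEmbedding _)]
    refine lintegral_congr fun x => ?_
    rw [Fin.prod_univ_succ]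
    rfl

/-- Split at t = σ. Below, t + σ is replaced by σ and β > -1 gives integrability at 0; above, it is
replaced by t and M > β + 1 gives integrability at infinity. -/
theorem lintegral_Ioi_rpow_mul_add_rpow_le {β M : ℝ} (hβ : -1 < β) (hM : β + 1 < M) :
    ∃ C : ℝ, 0 < C ∧ ∀ σ : ℝ, 0 < σ →
      ∫⁻ t in Ioi 0, ENNReal.ofReal (t ^ β * (t + σ) ^ (-M)) ≤
        ENNReal.ofReal (C * σ ^ (β + 1 - M)) := by
  have h1 : 0 < β + 1 := by linarith
  have h2 : 0 < M - β - 1 := by linarith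
  refine ⟨1 / (β + 1) + 1 / (M - β - 1), by positivity, fun σ hσ => ?_⟩
  have hM0 : -M ≤ 0 := by linarith
  rw [← Ioc_union_Ioi_eq_Ioi hσ.le]
  refine (lintegral_union_le _ _ _).trans ?_
  have e1 : ∫⁻ t in Ioc 0 σ, ENNReal.ofReal (t ^ β * (t + σ) ^ (-M)) ≤
      ENNReal.ofReal (1 / (β + 1) * σ ^ (β + 1 - M)) := by
    calc ∫⁻ t in Ioc 0 σ, ENNReal.ofReal (t ^ β * (t + σ) ^ (-M))
        ≤ ∫⁻ t in Ioc 0 σ, ENNReal.ofReal (t ^ β * σ ^ (-M)) := by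
          refine setLIntegral_mono' measurableSet_Ioc fun t ht => ENNReal.ofReal_le_ofReal ?_
          exact mul_le_mul_of_nonneg_left
            (Real.rpow_le_rpow_of_nonpos hσ (by linarith [ht.1]) hM0) (Real.rpow_nonneg ht.1.le _)
      _ = ENNReal.ofReal (∫ t in Ioc 0 σ, t ^ β * σ ^ (-M)) := by
          refine (ofReal_integral_eq_lintegral_ofReal ?_ ?_).symm
          · have := (intervalIntegral.intervalIntegrable_rpow' (a := 0) (b := σ) hβ)
            rw [intervalIntegrable_iff_integrableOn_Ioc_of_le hσ.le] at this
            exact this.mul_const _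
          · filter_upwards [ae_restrict_mem measurableSet_Ioc] with t ht
            exact mul_nonneg (Real.rpow_nonneg ht.1.le _) (Real.rpow_nonneg hσ.le _)
      _ = ENNReal.ofReal (1 / (β + 1) * σ ^ (β + 1 - M)) := by
          rw [integral_mul_const, ← intervalIntegral.integral_of_le hσ.le,
            integral_rpow (Or.inl hβ), Real.zero_rpow h1.ne',
            show σ ^ (β + 1 - M) = σ ^ (β + 1) * σ ^ (-M) by
              rw [← Real.rpow_add hσ, ← sub_eq_add_neg]]
          congr 1
          ring
  have e2 : ∫⁻ t in Ioi σ, ENNReal.ofReal (t ^ β * (t + σ) ^ (-M)) ≤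
      ENNReal.ofReal (1 / (M - β - 1) * σ ^ (β + 1 - M)) := by
    calc ∫⁻ t in Ioi σ, ENNReal.ofReal (t ^ β * (t + σ) ^ (-M))
        ≤ ∫⁻ t in Ioi σ, ENNReal.ofReal (t ^ (β - M)) := by
          refine setLIntegral_mono' measurableSet_Ioi fun t ht => ENNReal.ofReal_le_ofReal ?_
          have ht0 : 0 < t := hσ.trans ht
          rw [sub_eq_add_neg, Real.rpow_add ht0]
          exact mul_le_mul_of_nonneg_left
            (Real.rpow_le_rpow_of_nonpos ht0 (by linarith) hM0) (Real.rpow_nonneg ht0.le _)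
      _ = ENNReal.ofReal (∫ t in Ioi σ, t ^ (β - M)) := by
          refine (ofReal_integral_eq_lintegral_ofReal
            (integrableOn_Ioi_rpow_of_lt (by linarith) hσ) ?_).symm
          filter_upwards [ae_restrict_mem measurableSet_Ioi] with t ht
          exact Real.rpow_nonneg (hσ.trans ht).le _
      _ = ENNReal.ofReal (1 / (M - β - 1) * σ ^ (β + 1 - M)) := by
          rw [integral_Ioi_rpow_of_lt (by linarith) hσ, show β - M + 1 = β + 1 - M by ring]
          congr 1
          rw [neg_div, ← div_neg, one_div, inv_mul_eq_div]
          congr 1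
          ring
  refine (add_le_add e1 e2).trans ?_
  rw [← ENNReal.ofReal_add (by positivity) (by positivity), add_mul]

theorem lintegral_abs_sub_add_rpow_le {M : ℝ} (hM : 1 < M) :
    ∃ C : ℝ, 0 < C ∧ ∀ σ : ℝ, 0 < σ → ∀ y : ℝ,
      ∫⁻ u, ENNReal.ofReal ((|u - y| + σ) ^ (-M)) ≤ ENNReal.ofReal (C * σ ^ (1 - M)) := by
  obtain ⟨C, hC, h⟩ := lintegral_Ioi_rpow_mul_add_rpow_le (β := 0) (M := M) (by norm_num)
    (by linarith)
  refine ⟨C + C, by positivity, fun σ hσ y => ?_⟩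
  rw [lintegral_sub_right_eq_self (fun u => ENNReal.ofReal ((|u| + σ) ^ (-M))) y]
  have hpos : ∫⁻ u in Ioi 0, ENNReal.ofReal ((|u| + σ) ^ (-M)) ≤
      ENNReal.ofReal (C * σ ^ (1 - M)) := by
    have := h σ hσ
    rw [zero_add] at this
    refine le_trans (le_of_eq (setLIntegral_congr_fun measurableSet_Ioi fun u hu => ?_)) this
    simp [abs_of_pos (mem_Ioi.1 hu)]
  have hneg : ∫⁻ u in Iic 0, ENNReal.ofReal ((|u| + σ) ^ (-M)) ≤
      ENNReal.ofReal (C * σ ^ (1 - M)) := by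
    refine le_trans (le_of_eq ?_) hpos
    rw [← (Measure.measurePreserving_neg (volume : Measure ℝ)).setLIntegral_comp_preimage_emb
      (MeasurableEquiv.neg ℝ).measurableEmbedding]
    simp only [abs_neg]
    refine setLIntegral_congr ?_
    have : (Neg.neg : ℝ → ℝ) ⁻¹' Iic 0 = Ici 0 := by ext; simp
    rw [this]
    exact Ioi_ae_eq_Ici.symm
  rw [← setLIntegral_univ, ← Iic_union_Ioi (a := (0 : ℝ))]
  refine (lintegral_union_le _ _ _).trans ((add_le_add hneg hpos).trans ?_)
  rw [← ENNReal.ofReal_add (by positivity) (by positivity), add_mul]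

theorem reflect_last {n : ℕ} (w : Pt n) : reflect w (Fin.last n) = -height w := by
  simp [reflect]

theorem reflect_castSucc {n : ℕ} (w : Pt n) (i : Fin n) :
    reflect w i.castSucc = w i.castSucc := by
  simp [reflect]

theorem height_add_height_le {n : ℕ} (z w : Pt n) :
    height z + height w ≤ ‖z - reflect w‖ := by
  have := (le_abs_self _).trans (PiLp.norm_apply_le (z - reflect w) (Fin.last n))
  simpa [reflect_last, height] using this

theorem abs_sub_le_norm_sub_reflect {n : ℕ} (z w : Pt n) (i : Fin n) :
    |z i.castSucc - w i.castSucc| ≤ ‖z - reflect w‖ := by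
  have := PiLp.norm_apply_le (z - reflect w) i.castSucc
  simpa [reflect_castSucc] using this

theorem continuous_height {n : ℕ} : Continuous (height : Pt n → ℝ) := by
  unfold height; fun_prop

theorem isOpen_upperHalf (n : ℕ) : IsOpen (upperHalf n) :=
  isOpen_lt continuous_const continuous_height

/-- The distance |z - w̄| dominates each horizontal difference as well as the sum of the heights.
Distributing the power M over the coordinates therefore bounds the integrand by a product of
one-variable functions, and Tonelli reduces to the one-dimensional estimates. -/
theorem lintegral_height_rpow_mul_norm_rpow_le (n : ℕ) {β M : ℝ} (hβ : -1 < β)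
    (hM : β + n + 1 < M) :
    ∃ C : ℝ, 0 < C ∧ ∀ w ∈ upperHalf n,
      ∫⁻ z in upperHalf n, ENNReal.ofReal (height z ^ β * ‖z - reflect w‖ ^ (-M)) ≤
        ENNReal.ofReal (C * height w ^ (β + n + 1 - M)) := by
  -- The excess M - (β + n + 1) is shared equally by the n + 1 coordinates: each horizontal one
  -- receives the power 1 + ε, the vertical one β + 1 + ε.
  obtain ⟨ε, hε, hεM⟩ : ∃ ε : ℝ, 0 < ε ∧ M = β + 1 + ε + n * (1 + ε) :=
    ⟨(M - β - 1 - n) / (n + 1), div_pos (by linarith) (by positivity), by field_simp; ring⟩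
  obtain ⟨A, hA, hA'⟩ := lintegral_Ioi_rpow_mul_add_rpow_le (M := β + 1 + ε) hβ (by linarith)
  obtain ⟨B, hB, hB'⟩ := lintegral_abs_sub_add_rpow_le (M := 1 + ε) (by linarith)
  refine ⟨A * (2 ^ (1 + ε) * B) ^ n, by positivity, fun w hw => ?_⟩
  have hσ : 0 < height w := hw
  set σ := height w with hσdef
  let g : Fin n → ℝ → ℝ≥0∞ := fun i u =>
    ENNReal.ofReal (2 ^ (1 + ε)) * ENNReal.ofReal ((|u - w i.castSucc| + σ) ^ (-(1 + ε)))
  let g' : ℝ → ℝ≥0∞ := (Ioi 0).indicator fun t =>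
    ENNReal.ofReal (t ^ β * (t + σ) ^ (-(β + 1 + ε)))
  let f : Fin (n + 1) → ℝ → ℝ≥0∞ := Fin.snoc (α := fun _ => ℝ → ℝ≥0∞) g g'
  have hf : ∀ i, Measurable (f i) := by
    refine Fin.lastCases ?_ fun i => ?_
    · simp only [f, Fin.snoc_last]
      exact Measurable.indicator (by fun_prop) measurableSet_Ioi
    · simp only [f, Fin.snoc_castSucc, g]
      fun_prop
  have key : ∀ z : Pt n, (upperHalf n).indicator
      (fun z => ENNReal.ofReal (height z ^ β * ‖z - reflect w‖ ^ (-M))) z ≤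
      ∏ i, f i (z i) := by
    intro z
    by_cases hz : z ∈ upperHalf n
    swap
    · simp [hz]
    have hz' : 0 < height z := hz
    rw [indicator_of_mem hz, Fin.prod_univ_castSucc]
    simp only [f, Fin.snoc_last, Fin.snoc_castSucc, g]
    have : g' (z (Fin.last n)) =
        ENNReal.ofReal (height z ^ β * (height z + σ) ^ (-(β + 1 + ε))) :=
      indicator_of_mem (s := Ioi (0 : ℝ)) hz' _
    rw [this]
    have hD := height_add_height_le z w
    have hD0 : 0 < ‖z - reflect w‖ := by linarith
    have hsplit : ‖z - reflect w‖ ^ (-M) =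
        (∏ _i : Fin n, ‖z - reflect w‖ ^ (-(1 + ε))) * ‖z - reflect w‖ ^ (-(β + 1 + ε)) := by
      rw [Finset.prod_const, Finset.card_univ, Fintype.card_fin, ← Real.rpow_mul_natCast hD0.le,
        ← Real.rpow_add hD0, hεM]
      congr 1
      ring
    have hle : ∀ i : Fin n, ‖z - reflect w‖ ^ (-(1 + ε)) ≤
        2 ^ (1 + ε) * (|z i.castSucc - w i.castSucc| + σ) ^ (-(1 + ε)) := by
      intro i
      have h0 : 0 ≤ |z i.castSucc - w i.castSucc| := abs_nonneg _
      have h1 := abs_sub_le_norm_sub_reflect z w i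
      -- The distance is at least each of the two summands, hence at least their mean; this produces
      -- the factor 2^(1 + ε).
      have h2 : (|z i.castSucc - w i.castSucc| + σ) / 2 ≤ ‖z - reflect w‖ := by linarith
      refine (Real.rpow_le_rpow_of_nonpos (by positivity) h2 (by linarith)).trans (le_of_eq ?_)
      rw [Real.div_rpow (by positivity) (by norm_num), Real.rpow_neg (x := 2) (by norm_num),
        div_inv_eq_mul, mul_comm]
    have hle' : ‖z - reflect w‖ ^ (-(β + 1 + ε)) ≤ (height z + σ) ^ (-(β + 1 + ε)) :=
      Real.rpow_le_rpow_of_nonpos (by linarith) hD (by linarith)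
    simp_rw [← ENNReal.ofReal_mul (show (0 : ℝ) ≤ 2 ^ (1 + ε) by positivity)]
    rw [← ENNReal.ofReal_prod_of_nonneg (fun i _ => by positivity),
      ← ENNReal.ofReal_mul (Finset.prod_nonneg fun i _ => by positivity)]
    refine ENNReal.ofReal_le_ofReal ?_
    rw [hsplit]
    have hp := Finset.prod_le_prod (s := Finset.univ) (fun (i : Fin n) _ => by positivity)
      fun (i : Fin n) _ => hle i
    calc height z ^ β * ((∏ _i : Fin n, ‖z - reflect w‖ ^ (-(1 + ε))) *
          ‖z - reflect w‖ ^ (-(β + 1 + ε)))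
        = (∏ _i : Fin n, ‖z - reflect w‖ ^ (-(1 + ε))) *
          (height z ^ β * ‖z - reflect w‖ ^ (-(β + 1 + ε))) := by ring
      _ ≤ _ := mul_le_mul hp (mul_le_mul_of_nonneg_left hle' (by positivity)) (by positivity)
          (Finset.prod_nonneg fun i _ => by positivity)
  rw [← lintegral_indicator (isOpen_upperHalf n).measurableSet]
  refine (lintegral_mono key).trans ?_
  have hpi : ∫⁻ z : Pt n, ∏ i, f i (z i) = ∏ i, ∫⁻ t, f i t := by
    rw [← lintegral_pi_prod _ f hf]
    exact (PiLp.volume_preserving_ofLp (Fin (n + 1))).lintegral_comp_emb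
      (MeasurableEquiv.toLp 2 (Fin (n + 1) → ℝ)).symm.measurableEmbedding
      (fun x => ∏ i, f i (x i))
  rw [hpi, Fin.prod_univ_castSucc]
  simp only [f, Fin.snoc_last, Fin.snoc_castSucc]
  have hg' : ∫⁻ t, g' t ≤ ENNReal.ofReal (A * σ ^ (-ε)) := by
    have := hA' σ hσ
    rw [show β + 1 - (β + 1 + ε) = -ε by ring] at this
    exact (lintegral_indicator measurableSet_Ioi _).trans_le this
  have hg : ∀ i, ∫⁻ t, g i t ≤ ENNReal.ofReal (2 ^ (1 + ε) * B * σ ^ (-ε)) := by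
    intro i
    have := hB' σ hσ (w i.castSucc)
    rw [show 1 - (1 + ε) = -ε by ring] at this
    rw [lintegral_const_mul _ (by fun_prop), mul_assoc,
      ENNReal.ofReal_mul (show (0 : ℝ) ≤ 2 ^ (1 + ε) by positivity)]
    gcongr
  refine (mul_le_mul' (Finset.prod_le_prod' fun i _ => hg i) hg').trans (le_of_eq ?_)
  rw [Finset.prod_const, Finset.card_univ, Fintype.card_fin, ← ENNReal.ofReal_pow (by positivity),
    ← ENNReal.ofReal_mul (by positivity)]
  congr 1
  rw [mul_pow, ← Real.rpow_mul_natCast hσ.le,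
    show β + n + 1 - M = -ε * n + -ε by rw [hεM]; ring, Real.rpow_add hσ]
  ring

/-! ### Geometry of cubes and of the reflection -/

/-- The open cube with center `c` and side `2 r`. -/
def openCube {n : ℕ} (c : Pt n) (r : ℝ) : Set (Pt n) := {z | ∀ i, |z i - c i| < r}

theorem openCube_subset_cube {n : ℕ} (c : Pt n) (r : ℝ) : openCube c r ⊆ cube c r :=
  fun _ hz i => (hz i).le

theorem isOpen_openCube {n : ℕ} (c : Pt n) (r : ℝ) : IsOpen (openCube c r) := by
  have : openCube c r = ⋂ i, {z | |z i - c i| < r} := by ext; simp [openCube]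
  rw [this]
  exact isOpen_iInter_of_finite fun i => isOpen_lt (by fun_prop) continuous_const

theorem volume_openCube {n : ℕ} (c : Pt n) (r : ℝ) :
    volume (openCube c r) = ENNReal.ofReal (2 * r) ^ (n + 1) := by
  have h : openCube c r = (WithLp.ofLp : Pt n → Fin (n + 1) → ℝ) ⁻¹'
      (univ.pi fun i => Metric.ball (c i) r) := by
    ext z; simp [openCube, Real.dist_eq]
  rw [h, (PiLp.volume_preserving_ofLp (Fin (n + 1))).measure_preimage
    (MeasurableSet.univ_pi fun i => measurableSet_ball).nullMeasurableSet, volume_pi_pi]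
  simp [Real.volume_ball]

theorem isClosed_cube {n : ℕ} (c : Pt n) (r : ℝ) : IsClosed (cube c r) := by
  have : cube c r = ⋂ i, {z | |z i - c i| ≤ r} := by ext; simp [cube]
  rw [this]
  exact isClosed_iInter fun i => isClosed_le (by fun_prop) continuous_const

theorem norm_sub_le_of_mem_cube {n : ℕ} {c z : Pt n} {r : ℝ} (hr : 0 ≤ r) (hz : z ∈ cube c r) :
    ‖z - c‖ ≤ (n + 1) * r := by
  rw [EuclideanSpace.norm_eq]
  refine Real.sqrt_le_iff.2 ⟨by positivity, ?_⟩
  calc ∑ i, ‖(z - c) i‖ ^ 2 ≤ ∑ _i : Fin (n + 1), r ^ 2 :=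
        Finset.sum_le_sum fun i _ => pow_le_pow_left₀ (norm_nonneg _) (hz i) 2
    _ = (n + 1) * r ^ 2 := by simp
    _ ≤ ((n + 1) * r) ^ 2 := by
        rw [mul_pow]
        gcongr
        exact le_self_pow₀ (by linarith [(Nat.cast_nonneg n : (0 : ℝ) ≤ n)]) two_ne_zero

/-- The point `(y, s + a)`, where `w = (y, s)`. -/
noncomputable def vshift {n : ℕ} (w : Pt n) (a : ℝ) : Pt n := w + EuclideanSpace.single (Fin.last n) a

theorem height_vshift {n : ℕ} (w : Pt n) (a : ℝ) : height (vshift w a) = height w + a := by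
  simp [height, vshift]

theorem dist_vshift_vshift {n : ℕ} (w : Pt n) (a b : ℝ) :
    dist (vshift w a) (vshift w b) = |a - b| := by
  simp [vshift, Real.dist_eq]

theorem vshift_mem_cube {n : ℕ} (c : Pt n) {r a : ℝ} (ha : |a| ≤ r) : vshift c a ∈ cube c r := by
  intro i
  by_cases hi : i = Fin.last n
  · subst hi; simpa [vshift] using ha
  · simpa [vshift, hi] using (abs_nonneg a).trans ha

theorem mem_frontier_upperHalf {n : ℕ} {w : Pt n} (hw : height w = 0) :
    w ∈ frontier (upperHalf n) := by
  rw [(isOpen_upperHalf n).frontier_eq]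
  refine ⟨Metric.mem_closure_iff.2 fun ε hε => ⟨vshift w (ε / 2), ?_, ?_⟩, fun h => ?_⟩
  · simp only [upperHalf, mem_ofPred_eq, height_vshift]
    linarith
  · have := dist_vshift_vshift w 0 (ε / 2)
    have h0 : vshift w 0 = w := by simp [vshift]
    rw [h0] at this
    rw [this, zero_sub, abs_neg, abs_of_pos (by linarith)]
    linarith
  · exact absurd hw (ne_of_gt h)

theorem height_nonpos_of_mem_frontier {n : ℕ} {w : Pt n} (hw : w ∈ frontier (upperHalf n)) :
    height w ≤ 0 := by
  rw [(isOpen_upperHalf n).frontier_eq] at hw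
  exact not_lt.1 hw.2

theorem height_sub_height_le_dist {n : ℕ} (z w : Pt n) : height z - height w ≤ dist z w := by
  rw [dist_eq_norm]
  exact (le_abs_self _).trans (PiLp.norm_apply_le (z - w) (Fin.last n))

theorem bddBelow_image2_dist {n : ℕ} (A B : Set (Pt n)) : BddBelow (Set.image2 dist A B) :=
  ⟨0, by rintro _ ⟨x, _, y, _, rfl⟩; exact dist_nonneg⟩

/-- The minimum is attained between the center of the bottom face and its vertical projection to the
boundary. -/
theorem setDist_cube_frontier {n : ℕ} {c : Pt n} {r : ℝ} (hr : 0 ≤ r)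
    (hrc : r ≤ height c) : setDist (cube c r) (frontier (upperHalf n)) = height c - r := by
  have hmem : vshift c (-r) ∈ cube c r := vshift_mem_cube c (by rw [abs_neg, abs_of_nonneg hr])
  have hmem' : vshift c (-height c) ∈ frontier (upperHalf n) :=
    mem_frontier_upperHalf (by rw [height_vshift]; ring)
  refine le_antisymm ?_ (le_csInf ⟨_, mem_image2_of_mem hmem hmem'⟩ ?_)
  · refine (csInf_le (bddBelow_image2_dist _ _) (mem_image2_of_mem hmem hmem')).trans ?_
    rw [dist_vshift_vshift, abs_of_nonneg (by linarith)]
    linarith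
  · rintro _ ⟨z, hz, w, hw, rfl⟩
    have h1 := height_sub_height_le_dist z w
    have h2 := height_nonpos_of_mem_frontier hw
    have h3 := (abs_le.1 (hz (Fin.last n))).1
    change -r ≤ height z - height c at h3
    linarith

theorem diam_cube_le {n : ℕ} (c : Pt n) {r : ℝ} (hr : 0 ≤ r) :
    Metric.diam (cube c r) ≤ 2 * (n + 1) * r := by
  refine Metric.diam_le_of_forall_dist_le (by positivity) fun x hx y hy => ?_
  have h1 := norm_sub_le_of_mem_cube hr hx
  have h2 := norm_sub_le_of_mem_cube hr hy
  rw [← dist_eq_norm] at h1 h2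
  linarith [dist_triangle_right x y c]

theorem le_diam_cube {n : ℕ} (c : Pt n) {r : ℝ} (hr : 0 ≤ r) :
    2 * r ≤ Metric.diam (cube c r) := by
  have hb : Bornology.IsBounded (cube c r) :=
    (Metric.isBounded_iff_subset_closedBall c).2 ⟨(n + 1) * r, fun z hz => by
      rw [Metric.mem_closedBall, dist_eq_norm]; exact norm_sub_le_of_mem_cube hr hz⟩
  have := Metric.dist_le_diam_of_mem hb (vshift_mem_cube c (abs_of_nonneg hr).le)
    (vshift_mem_cube c (show |-r| ≤ r by rw [abs_neg, abs_of_nonneg hr]))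
  rw [dist_vshift_vshift, abs_of_nonneg (by linarith)] at this
  linarith

theorem norm_sub_reflect_le {n : ℕ} (z c w : Pt n) :
    ‖z - reflect w‖ ≤ ‖c - reflect w‖ + ‖z - c‖ := by
  rw [show z - reflect w = (c - reflect w) + (z - c) by abel]
  exact norm_add_le _ _

/-- Reflection is an isometric involution. The symmetry lets estimates in the first variable be used
in the second. -/
theorem norm_sub_reflect_comm {n : ℕ} (z w : Pt n) : ‖z - reflect w‖ = ‖w - reflect z‖ := by
  rw [EuclideanSpace.norm_eq, EuclideanSpace.norm_eq]
  congr 1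
  refine Finset.sum_congr rfl (Fin.lastCases ?_ fun i => ?_) <;> intros
  · simp [reflect_last, height, add_comm]
  · simp [reflect_castSucc, abs_sub_comm]

theorem continuous_reflect {n : ℕ} : Continuous (reflect : Pt n → Pt n) := by
  unfold reflect height
  refine (PiLp.continuous_toLp 2 _).comp ?_
  exact (by fun_prop : Continuous fun z : Pt n => fun i => z i).update _ (by fun_prop)

theorem norm_self_sub_reflect {n : ℕ} (w : Pt n) : ‖w - reflect w‖ = 2 * |height w| := by
  have : w - reflect w = EuclideanSpace.single (Fin.last n) (2 * height w) := by
    ext i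
    refine Fin.lastCases ?_ (fun i => ?_) i
    · simp [reflect_last, height]; ring
    · simp [reflect_castSucc]
  rw [this, PiLp.norm_single, Real.norm_eq_abs, abs_mul, abs_two]

/-! ### Comparability on Whitney cubes -/

namespace IsWhitney

variable {n : ℕ} {c : ℕ → Pt n} {r : ℕ → ℝ}

theorem cube_subset (hW : IsWhitney c r) (k : ℕ) : cube (c k) (r k) ⊆ upperHalf n :=
  hW.iUnion_eq ▸ subset_iUnion (fun k => cube (c k) (r k)) k

theorem lt_height (hW : IsWhitney c r) (k : ℕ) : r k < height (c k) := by
  have := hW.cube_subset k (vshift_mem_cube (c k) (a := -r k)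
    (by rw [abs_neg, abs_of_pos (hW.pos k)]))
  simp only [upperHalf, mem_ofPred_eq, height_vshift] at this
  linarith

theorem pairwise_disjoint_openCube (hW : IsWhitney c r) :
    Pairwise (Function.onFun Disjoint fun k => openCube (c k) (r k)) := fun _ _ hjk =>
  (hW.disjoint_interior hjk).mono
    (interior_maximal (openCube_subset_cube _ _) (isOpen_openCube _ _))
    (interior_maximal (openCube_subset_cube _ _) (isOpen_openCube _ _))

/-- The distance from the cube to the boundary is height (c k) - r k, so the Whitney condition makes
r k comparable to the heights in the cube. A point of the cube is within (n + 1) r k of the center,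
and heights are bounded by distances to reflected points, so moving to the center changes such a
distance by a bounded factor only. -/
theorem exists_comparable (hW : IsWhitney c r) :
    ∃ L : ℝ, 1 ≤ L ∧ ∀ k, height (c k) ≤ L * r k ∧ ∀ z ∈ cube (c k) (r k),
      height (c k) ≤ L * height z ∧ height z ≤ L * height (c k) ∧
      ∀ w ∈ upperHalf n, ‖z - reflect w‖ ≤ L * ‖c k - reflect w‖ ∧
        ‖c k - reflect w‖ ≤ L * ‖z - reflect w‖ := by
  obtain ⟨a, b, ha, hb, hab⟩ := hW.diam_comparable
  have hn : (0 : ℝ) ≤ n := Nat.cast_nonneg n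
  have hia : 0 < 1 / (2 * a) := by positivity
  have hbn : 0 ≤ b * (2 * (n + 1)) := by positivity
  have hna : 0 ≤ (n + 1) * (1 / (2 * a)) := by positivity
  -- A sum of nonnegative terms, large enough to dominate the constant of each of the five
  -- inequalities.
  obtain ⟨L, hL⟩ : ∃ L : ℝ, L = 2 + 1 / (2 * a) + b * (2 * (n + 1)) + (n + 1) * (1 / (2 * a)) + n :=
    ⟨_, rfl⟩
  refine ⟨L, by linarith, fun k => ?_⟩
  have hr := hW.pos k
  have hrc := hW.lt_height k
  have hd := hab k
  rw [setDist_cube_frontier hr.le hrc.le] at hd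
  have h1 : r k ≤ 1 / (2 * a) * (height (c k) - r k) := by
    have := (mul_le_mul_of_nonneg_left (le_diam_cube (c k) hr.le) ha.le).trans hd.1
    rw [one_div, inv_mul_eq_div, le_div_iff₀ (by positivity)]
    linarith
  have h2 : height (c k) - r k ≤ b * (2 * (n + 1)) * r k := by
    have := hd.2.trans (mul_le_mul_of_nonneg_left (diam_cube_le (c k) hr.le) hb.le)
    linarith
  have hη : 0 < height (c k) := hr.trans hrc
  refine ⟨?_, fun z hz => ?_⟩
  · have : (1 + b * (2 * (n + 1))) * r k ≤ L * r k :=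
      mul_le_mul_of_nonneg_right (by linarith) hr.le
    linarith
  have hzl := abs_le.1 (hz (Fin.last n))
  change -r k ≤ height z - height (c k) ∧ height z - height (c k) ≤ r k at hzl
  have hz0 : 0 < height z := hW.cube_subset k hz
  have h3 : r k ≤ 1 / (2 * a) * height z :=
    h1.trans (mul_le_mul_of_nonneg_left (by linarith) hia.le)
  have hzc := norm_sub_le_of_mem_cube hr.le hz
  refine ⟨?_, ?_, fun w hw => ⟨?_, ?_⟩⟩
  · have : (1 + 1 / (2 * a)) * height z ≤ L * height z :=
      mul_le_mul_of_nonneg_right (by linarith) hz0.le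
    linarith
  · have : 2 * height (c k) ≤ L * height (c k) :=
      mul_le_mul_of_nonneg_right (by linarith) hη.le
    linarith
  · have hw0 : 0 < height w := hw
    have h4 := height_add_height_le (c k) w
    have h5 : (n + 1) * r k ≤ (n + 1) * ‖c k - reflect w‖ :=
      mul_le_mul_of_nonneg_left (by linarith) (by positivity)
    have h6 := norm_sub_reflect_le z (c k) w
    have : (1 + (n + 1)) * ‖c k - reflect w‖ ≤ L * ‖c k - reflect w‖ :=
      mul_le_mul_of_nonneg_right (by linarith) (norm_nonneg _)
    linarith
  · have hw0 : 0 < height w := hw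
    have h4 := height_add_height_le z w
    have h5 : (n + 1) * r k ≤ (n + 1) * (1 / (2 * a) * ‖z - reflect w‖) :=
      mul_le_mul_of_nonneg_left (h3.trans (mul_le_mul_of_nonneg_left (by linarith) hia.le))
        (by positivity)
    have h6 := norm_sub_reflect_le (c k) z w
    rw [norm_sub_rev (c k) z] at h6
    have : (1 + (n + 1) * (1 / (2 * a))) * ‖z - reflect w‖ ≤ L * ‖z - reflect w‖ :=
      mul_le_mul_of_nonneg_right (by linarith) (norm_nonneg _)
    linarith

end IsWhitney

/-! ### Powers of comparable numbers, Hölder for series, and the weighted measure -/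

/-- Comparability is assumed in both directions because the exponent may have either sign. -/
theorem rpow_le_rpow_abs_mul_rpow {x y L : ℝ} (hx : 0 < x) (hy : 0 < y) (hL : 1 ≤ L)
    (hxy : x ≤ L * y) (hyx : y ≤ L * x) (b : ℝ) : x ^ b ≤ L ^ |b| * y ^ b := by
  have hL0 : 0 < L := by linarith
  rcases le_total 0 b with hb | hb
  · rw [abs_of_nonneg hb, ← Real.mul_rpow hL0.le hy.le]
    exact Real.rpow_le_rpow hx.le hxy hb
  · rw [abs_of_nonpos hb, Real.rpow_neg hL0.le, ← Real.inv_rpow hL0.le,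
      ← Real.mul_rpow (inv_nonneg.2 hL0.le) hy.le]
    refine Real.rpow_le_rpow_of_nonpos (by positivity) ?_ hb
    rw [inv_mul_le_iff₀ hL0]
    exact hyx

/-- Hölder's inequality for counting measure with conjugate exponents s/(s - 1) and s, raised to the
power s. -/
theorem tsum_mul_rpow_le {s : ℝ} (hs : 1 < s) (u v : ℕ → ℝ≥0∞) :
    (∑' k, u k * v k) ^ s ≤ (∑' k, u k ^ (s / (s - 1))) ^ (s - 1) * ∑' k, v k ^ s := by
  have hs0 : 0 < s := by linarith
  have hs1 : 0 < s - 1 := by linarith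
  have hc : (s / (s - 1)).HolderConjugate s := by
    refine ⟨?_, by positivity, hs0⟩
    field_simp
    ring
  have h := ENNReal.lintegral_mul_le_Lp_mul_Lq Measure.count hc
    (measurable_of_countable u).aemeasurable (measurable_of_countable v).aemeasurable
  simp only [lintegral_count, Pi.mul_apply] at h
  refine (ENNReal.rpow_le_rpow h hs0.le).trans (le_of_eq ?_)
  rw [ENNReal.mul_rpow_of_nonneg _ _ hs0.le, ← ENNReal.rpow_mul, ← ENNReal.rpow_mul,
    one_div_mul_cancel hs0.ne', ENNReal.rpow_one]
  congr 2
  field_simp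

theorem norm_sub_reflect_pos {n : ℕ} {z w : Pt n} (hz : z ∈ upperHalf n) (hw : w ∈ upperHalf n) :
    0 < ‖z - reflect w‖ := by
  have h1 : 0 < height z := hz
  have h2 : 0 < height w := hw
  linarith [height_add_height_le z w]

theorem kernel_rpow {n : ℕ} {z : Pt n} (hz : z ∈ upperHalf n) (w : Pt n) (κ : ℝ) :
    kernel z w ^ κ = height z ^ (n * κ) * ‖z - reflect w‖ ^ (-(2 * (n * κ))) := by
  have hz0 : 0 < height z := hz
  rw [kernel, Real.div_rpow (by positivity) (by positivity), ← Real.rpow_natCast_mul hz0.le,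
    ← Real.rpow_natCast_mul (norm_nonneg _), Real.rpow_neg (norm_nonneg _), div_eq_mul_inv]
  congr 3
  push_cast
  ring

/-- The density is measurable and finite, so f may be arbitrary; no measurability in w of the inner
integral against μ has to be checked. -/
theorem lintegral_weightedVolume (n : ℕ) (b : ℝ) (f : Pt n → ℝ≥0∞) :
    ∫⁻ w, f w ∂(weightedVolume n b) =
      ∫⁻ w in upperHalf n, ENNReal.ofReal (height w ^ b) * f w := by
  have hm : Measurable (height : Pt n → ℝ) := continuous_height.measurable
  rw [weightedVolume, lintegral_withDensity_eq_lintegral_mul_non_measurable _ (by fun_prop)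
    (Filter.Eventually.of_forall fun _ => ENNReal.ofReal_lt_top)]
  rfl

/-! ### Passing between sums over cubes and integrals -/

namespace IsWhitney

variable {n : ℕ} {c : ℕ → Pt n} {r : ℕ → ℝ}

theorem center_mem (hW : IsWhitney c r) (k : ℕ) : c k ∈ upperHalf n :=
  (hW.pos k).trans (hW.lt_height k)

/-- The integrand on the right is comparable on the cube to its value at the center, and the volume
of the cube is at least a constant times the power n + 1 of the height of the center. -/
theorem ofReal_center_le_lintegral (hW : IsWhitney c r) (β M : ℝ) :
    ∃ C : ℝ, 0 < C ∧ ∀ k, ∀ w ∈ upperHalf n,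
      ENNReal.ofReal (height (c k) ^ (β + n + 1) * ‖c k - reflect w‖ ^ (-M)) ≤
        ENNReal.ofReal C * ∫⁻ z in openCube (c k) (r k),
          ENNReal.ofReal (height z ^ β * ‖z - reflect w‖ ^ (-M)) := by
  obtain ⟨L, hL, h⟩ := hW.exists_comparable
  have hL0 : 0 < L := by linarith
  refine ⟨L ^ |β| * L ^ |(-M)| * L ^ (n + 1), by positivity, fun k w hw => ?_⟩
  obtain ⟨hr, h⟩ := h k
  have hr0 := hW.pos k
  have hη : 0 < height (c k) := hW.center_mem k
  have hvol : ENNReal.ofReal (height (c k) ^ (n + 1)) ≤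
      ENNReal.ofReal (L ^ (n + 1)) * volume (openCube (c k) (r k)) := by
    rw [volume_openCube, ← ENNReal.ofReal_pow (by positivity), ← ENNReal.ofReal_mul (by positivity),
      ← mul_pow]
    refine ENNReal.ofReal_le_ofReal (pow_le_pow_left₀ hη.le (hr.trans ?_) _)
    exact mul_le_mul_of_nonneg_left (by linarith) hL0.le
  have hpt : ∀ z ∈ openCube (c k) (r k),
      ENNReal.ofReal (height (c k) ^ β * ‖c k - reflect w‖ ^ (-M)) ≤
        ENNReal.ofReal (L ^ |β| * L ^ |(-M)|) *
          ENNReal.ofReal (height z ^ β * ‖z - reflect w‖ ^ (-M)) := by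
    intro z hz
    have hz' := openCube_subset_cube _ _ hz
    obtain ⟨h1, h2, h3⟩ := h z hz'
    obtain ⟨h3, h4⟩ := h3 w hw
    have hzH := hW.cube_subset k hz'
    have hz0 : 0 < height z := hzH
    rw [← ENNReal.ofReal_mul (by positivity)]
    refine ENNReal.ofReal_le_ofReal ?_
    calc height (c k) ^ β * ‖c k - reflect w‖ ^ (-M)
        ≤ (L ^ |β| * height z ^ β) * (L ^ |(-M)| * ‖z - reflect w‖ ^ (-M)) :=
          mul_le_mul (rpow_le_rpow_abs_mul_rpow hη hz0 hL h1 h2 β)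
            (rpow_le_rpow_abs_mul_rpow (norm_sub_reflect_pos (hW.center_mem k) hw)
              (norm_sub_reflect_pos hzH hw) hL h4 h3 _) (by positivity) (by positivity)
      _ = _ := by ring
  calc ENNReal.ofReal (height (c k) ^ (β + n + 1) * ‖c k - reflect w‖ ^ (-M))
      = ENNReal.ofReal (height (c k) ^ (n + 1)) *
          ENNReal.ofReal (height (c k) ^ β * ‖c k - reflect w‖ ^ (-M)) := by
        rw [← ENNReal.ofReal_mul (by positivity), add_assoc, Real.rpow_add hη,
          ← Nat.cast_add_one, Real.rpow_natCast]
        congr 1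
        ring
    _ ≤ ENNReal.ofReal (L ^ (n + 1)) * volume (openCube (c k) (r k)) *
          ENNReal.ofReal (height (c k) ^ β * ‖c k - reflect w‖ ^ (-M)) := by gcongr
    _ = ENNReal.ofReal (L ^ (n + 1)) * ∫⁻ z in openCube (c k) (r k),
          ENNReal.ofReal (height (c k) ^ β * ‖c k - reflect w‖ ^ (-M)) := by
        rw [setLIntegral_const]; ring
    _ ≤ ENNReal.ofReal (L ^ (n + 1)) * ∫⁻ z in openCube (c k) (r k),
          ENNReal.ofReal (L ^ |β| * L ^ |(-M)|) *
            ENNReal.ofReal (height z ^ β * ‖z - reflect w‖ ^ (-M)) := by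
        gcongr 1
        exact setLIntegral_mono' (isOpen_openCube _ _).measurableSet hpt
    _ = _ := by
        rw [lintegral_const_mul' _ _ ENNReal.ofReal_ne_top, ← mul_assoc,
          ← ENNReal.ofReal_mul (by positivity)]
        congr 2
        ring

/-- Open cubes are genuinely disjoint, whereas closed ones may share faces. -/
theorem tsum_setLIntegral_openCube_le (hW : IsWhitney c r) (f : Pt n → ℝ≥0∞) :
    ∑' k, ∫⁻ z in openCube (c k) (r k), f z ≤ ∫⁻ z in upperHalf n, f z := by
  rw [← lintegral_iUnion (fun k => (isOpen_openCube _ _).measurableSet)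
    hW.pairwise_disjoint_openCube]
  exact lintegral_mono_set
    (iUnion_subset fun k => (openCube_subset_cube _ _).trans (hW.cube_subset k))

/-- The sum is dominated by the integral with β = 2N - δ - n - 1 and M = 2N. Here δ < 2N - n says β
> -1, and δ > 0 is convergence at infinity. -/
theorem tsum_ofReal_center_le (hW : IsWhitney c r) {N δ : ℝ} (hδ : 0 < δ)
    (hδN : δ < 2 * N - n) :
    ∃ C : ℝ, 0 < C ∧ ∀ w ∈ upperHalf n,
      ∑' k, ENNReal.ofReal (height (c k) ^ (2 * N - δ) * ‖c k - reflect w‖ ^ (-(2 * N))) ≤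
        ENNReal.ofReal (C * height w ^ (-δ)) := by
  obtain ⟨A, hA, hA'⟩ := hW.ofReal_center_le_lintegral (2 * N - δ - n - 1) (2 * N)
  obtain ⟨B, hB, hB'⟩ := lintegral_height_rpow_mul_norm_rpow_le n (β := 2 * N - δ - n - 1)
    (M := 2 * N) (by linarith) (by linarith)
  refine ⟨A * B, by positivity, fun w hw => ?_⟩
  have hB := hB' w hw
  rw [show 2 * N - δ - n - 1 + n + 1 - 2 * N = -δ by ring] at hB
  rw [show 2 * N - δ = 2 * N - δ - n - 1 + n + 1 by ring]
  refine (ENNReal.tsum_le_tsum fun k => hA' k w hw).trans ?_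
  rw [ENNReal.tsum_mul_left, mul_assoc, ENNReal.ofReal_mul hA.le]
  gcongr
  exact (hW.tsum_setLIntegral_openCube_le _).trans hB

theorem exists_le_kernel_rpow (hW : IsWhitney c r) {κ : ℝ} (hκ : 0 ≤ κ) :
    ∃ C : ℝ, 0 < C ∧ ∀ k, ∀ z ∈ cube (c k) (r k), ∀ w ∈ cube (c k) (r k),
      height (c k) ^ (-(n * κ)) ≤ C * kernel z w ^ κ := by
  obtain ⟨L, hL, h⟩ := hW.exists_comparable
  have hL0 : 0 < L := by linarith
  refine ⟨L ^ (n * κ) * (2 * L ^ 2) ^ (2 * (n * κ)), by positivity, fun k z hz w hw => ?_⟩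
  have hη : 0 < height (c k) := hW.center_mem k
  have hzH := hW.cube_subset k hz
  have hwH := hW.cube_subset k hw
  have hz0 : 0 < height z := hzH
  have hD := norm_sub_reflect_pos hzH hwH
  have hN : 0 ≤ n * κ := by positivity
  have h1 := ((h k).2 z hz).1
  -- Both points are moved to the center, one after the other by symmetry, and the center lies at
  -- distance 2 height (c k) from its own reflection.
  have h2 : ‖z - reflect w‖ ≤ 2 * L ^ 2 * height (c k) := by
    calc ‖z - reflect w‖ ≤ L * ‖c k - reflect w‖ := (((h k).2 z hz).2.2 w hwH).1
      _ = L * ‖w - reflect (c k)‖ := by rw [norm_sub_reflect_comm]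
      _ ≤ L * (L * ‖c k - reflect (c k)‖) :=
        mul_le_mul_of_nonneg_left (((h k).2 w hw).2.2 _ (hW.center_mem k)).1 hL0.le
      _ = 2 * L ^ 2 * height (c k) := by
        rw [norm_self_sub_reflect, abs_of_pos hη]; ring
  have h3 : height (c k) ^ (n * κ) ≤ L ^ (n * κ) * height z ^ (n * κ) := by
    rw [← Real.mul_rpow hL0.le hz0.le]
    exact Real.rpow_le_rpow hη.le h1 hN
  have h4 : height (c k) ^ (-(2 * (n * κ))) ≤
      (2 * L ^ 2) ^ (2 * (n * κ)) * ‖z - reflect w‖ ^ (-(2 * (n * κ))) := by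
    have := Real.rpow_le_rpow_of_nonpos hD h2 (z := -(2 * (n * κ))) (by linarith)
    rw [Real.mul_rpow (by positivity) hη.le, Real.rpow_neg (x := 2 * L ^ 2) (by positivity),
      inv_mul_le_iff₀ (by positivity)] at this
    exact this
  rw [kernel_rpow hzH]
  calc height (c k) ^ (-(n * κ))
      = height (c k) ^ (n * κ) * height (c k) ^ (-(2 * (n * κ))) := by
        rw [← Real.rpow_add hη]; congr 1; ring
    _ ≤ (L ^ (n * κ) * height z ^ (n * κ)) *
        ((2 * L ^ 2) ^ (2 * (n * κ)) * ‖z - reflect w‖ ^ (-(2 * (n * κ)))) :=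
        mul_le_mul h3 h4 (by positivity) (by positivity)
    _ = _ := by ring

/-! ### The sum is bounded by the integral -/

/-- Only the diagonal contribution, with z and w in the same cube, is kept. -/
theorem tsum_le_lintegral_kernel (hW : IsWhitney c r) {κ s : ℝ} (hκ : 0 ≤ κ) (hs : 0 ≤ s)
    (μ : Measure (Pt n)) :
    ∃ C : ℝ, 0 < C ∧
      ∑' k, ENNReal.ofReal (height (c k) ^ (-(n * κ) * (s - 1))) * μ (cube (c k) (r k)) ^ s ≤
        ENNReal.ofReal C * ∫⁻ w, (∫⁻ z in upperHalf n, ENNReal.ofReal (kernel z w ^ κ) ∂μ) ^ s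
          ∂(weightedVolume n (n * κ - n - 1)) := by
  obtain ⟨A, hA, hA'⟩ := hW.exists_le_kernel_rpow hκ
  -- With M = 0 this is a lower bound for the weighted volume of a cube by a constant times
  -- η_k^(nκ).
  obtain ⟨B, hB, hB'⟩ := hW.ofReal_center_le_lintegral (n * κ - n - 1) 0
  refine ⟨B * A ^ s, by positivity, ?_⟩
  rw [lintegral_weightedVolume]
  refine le_trans ?_ (mul_le_mul_right (hW.tsum_setLIntegral_openCube_le _) _)
  rw [← ENNReal.tsum_mul_left]
  refine ENNReal.tsum_le_tsum fun k => ?_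
  have hη : 0 < height (c k) := hW.center_mem k
  have hinner : ∀ w ∈ cube (c k) (r k),
      (ENNReal.ofReal (height (c k) ^ (-(n * κ))) * μ (cube (c k) (r k))) ^ s ≤
        ENNReal.ofReal (A ^ s) *
          (∫⁻ z in upperHalf n, ENNReal.ofReal (kernel z w ^ κ) ∂μ) ^ s := by
    intro w hw
    rw [← ENNReal.ofReal_rpow_of_nonneg hA.le hs, ← ENNReal.mul_rpow_of_nonneg _ _ hs]
    refine ENNReal.rpow_le_rpow ?_ hs
    rw [← lintegral_const_mul' _ _ ENNReal.ofReal_ne_top, ← setLIntegral_const]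
    refine le_trans ?_ (lintegral_mono_set (hW.cube_subset k))
    refine setLIntegral_mono' (isClosed_cube _ _).measurableSet fun z hz => ?_
    rw [← ENNReal.ofReal_mul hA.le]
    exact ENNReal.ofReal_le_ofReal (hA' k z hz w hw)
  have hvol := hB' k (c k) (hW.center_mem k)
  simp only [neg_zero, Real.rpow_zero, mul_one] at hvol
  rw [show (n : ℝ) * κ - n - 1 + n + 1 = n * κ by ring] at hvol
  calc ENNReal.ofReal (height (c k) ^ (-(n * κ) * (s - 1))) * μ (cube (c k) (r k)) ^ s
      = ENNReal.ofReal (height (c k) ^ (n * κ)) *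
          (ENNReal.ofReal (height (c k) ^ (-(n * κ))) * μ (cube (c k) (r k))) ^ s := by
        rw [ENNReal.mul_rpow_of_nonneg _ _ hs, ← mul_assoc,
          ENNReal.ofReal_rpow_of_nonneg (by positivity) hs, ← ENNReal.ofReal_mul (by positivity),
          ← Real.rpow_mul hη.le, ← Real.rpow_add hη]
        congr 3
        ring
    _ ≤ (ENNReal.ofReal B * ∫⁻ w in openCube (c k) (r k),
          ENNReal.ofReal (height w ^ (n * κ - n - 1))) *
          (ENNReal.ofReal (height (c k) ^ (-(n * κ))) * μ (cube (c k) (r k))) ^ s := by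
        gcongr
    _ ≤ ENNReal.ofReal B * ∫⁻ w in openCube (c k) (r k),
          ENNReal.ofReal (height w ^ (n * κ - n - 1)) *
          (ENNReal.ofReal (height (c k) ^ (-(n * κ))) * μ (cube (c k) (r k))) ^ s := by
        rw [mul_assoc]
        gcongr
        exact lintegral_mul_const_le _ _
    _ ≤ ENNReal.ofReal B * ∫⁻ w in openCube (c k) (r k), ENNReal.ofReal (A ^ s) *
          (ENNReal.ofReal (height w ^ (n * κ - n - 1)) *
          (∫⁻ z in upperHalf n, ENNReal.ofReal (kernel z w ^ κ) ∂μ) ^ s) := by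
        gcongr 1
        refine setLIntegral_mono' (isOpen_openCube _ _).measurableSet fun w hw => ?_
        rw [mul_left_comm]
        gcongr 1
        exact hinner w (openCube_subset_cube _ _ hw)
    _ = _ := by
        rw [lintegral_const_mul' _ _ ENNReal.ofReal_ne_top, ← mul_assoc, ENNReal.ofReal_mul hB.le]

/-! ### The integral is bounded by the sum -/

theorem lintegral_kernel_le_tsum (hW : IsWhitney c r) (κ : ℝ) (μ : Measure (Pt n)) :
    ∃ C : ℝ, 0 < C ∧ ∀ w ∈ upperHalf n,
      ∫⁻ z in upperHalf n, ENNReal.ofReal (kernel z w ^ κ) ∂μ ≤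
        ENNReal.ofReal C * ∑' k, ENNReal.ofReal
          (height (c k) ^ (n * κ) * ‖c k - reflect w‖ ^ (-(2 * (n * κ)))) *
            μ (cube (c k) (r k)) := by
  obtain ⟨L, hL, h⟩ := hW.exists_comparable
  have hL0 : 0 < L := by linarith
  refine ⟨L ^ |n * κ| * L ^ |(-(2 * (n * κ)))|, by positivity, fun w hw => ?_⟩
  rw [← ENNReal.tsum_mul_left, ← hW.iUnion_eq]
  refine (lintegral_iUnion_le _ _).trans (ENNReal.tsum_le_tsum fun k => ?_)
  rw [← mul_assoc, ← ENNReal.ofReal_mul (by positivity), ← setLIntegral_const]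
  refine setLIntegral_mono' (isClosed_cube _ _).measurableSet fun z hz =>
    ENNReal.ofReal_le_ofReal ?_
  obtain ⟨h1, h2, h3⟩ := (h k).2 z hz
  obtain ⟨h3, h4⟩ := h3 w hw
  have hη : 0 < height (c k) := hW.center_mem k
  have hzH := hW.cube_subset k hz
  have hz0 : 0 < height z := hzH
  rw [kernel_rpow hzH]
  calc height z ^ (n * κ) * ‖z - reflect w‖ ^ (-(2 * (n * κ)))
      ≤ (L ^ |n * κ| * height (c k) ^ (n * κ)) *
        (L ^ |(-(2 * (n * κ)))| * ‖c k - reflect w‖ ^ (-(2 * (n * κ)))) :=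
        mul_le_mul (rpow_le_rpow_abs_mul_rpow hz0 hη hL h2 h1 _)
          (rpow_le_rpow_abs_mul_rpow (norm_sub_reflect_pos hzH hw)
            (norm_sub_reflect_pos (hW.center_mem k) hw) hL h3 h4 _) (by positivity) (by positivity)
    _ = _ := by ring

/-- The coefficient is factored as x^((s-1)/s) y^(1/s), where x has height exponent 2N - δ, so that
∑ x_k is at most a constant times height(w)^(-δ). Both x and y keep the power -2N of the distance;
the height exponent of y is then forced by the total N. -/
theorem rpow_tsum_center_le (hW : IsWhitney c r) {N s δ : ℝ} (hs : 1 < s) (hδ : 0 < δ)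
    (hδN : δ < 2 * N - n) :
    ∃ C : ℝ, 0 < C ∧ ∀ w ∈ upperHalf n, ∀ m : ℕ → ℝ≥0∞,
      (∑' k, ENNReal.ofReal (height (c k) ^ N * ‖c k - reflect w‖ ^ (-(2 * N))) * m k) ^ s ≤
        ENNReal.ofReal (C * height w ^ (-δ * (s - 1))) *
          ∑' k, ENNReal.ofReal (height (c k) ^ (N - N * (s - 1) + δ * (s - 1)) *
            ‖c k - reflect w‖ ^ (-(2 * N))) * m k ^ s := by
  obtain ⟨A, hA, hA'⟩ := hW.tsum_ofReal_center_le hδ hδN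
  have hs0 : 0 < s := by linarith
  have hs1 : 0 < s - 1 := by linarith
  refine ⟨A ^ (s - 1), by positivity, fun w hw m => ?_⟩
  have hw0 : 0 < height w := hw
  let x : ℕ → ℝ := fun k => height (c k) ^ (2 * N - δ) * ‖c k - reflect w‖ ^ (-(2 * N))
  let y : ℕ → ℝ := fun k => height (c k) ^ (N - N * (s - 1) + δ * (s - 1)) *
    ‖c k - reflect w‖ ^ (-(2 * N))
  have hη : ∀ k, 0 < height (c k) := hW.center_mem
  have hD : ∀ k, 0 < ‖c k - reflect w‖ := fun k => norm_sub_reflect_pos (hW.center_mem k) hw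
  have hx : ∀ k, 0 < x k := fun k =>
    mul_pos (Real.rpow_pos_of_pos (hη k) _) (Real.rpow_pos_of_pos (hD k) _)
  have hy : ∀ k, 0 < y k := fun k =>
    mul_pos (Real.rpow_pos_of_pos (hη k) _) (Real.rpow_pos_of_pos (hD k) _)
  have hxy : ∀ k, height (c k) ^ N * ‖c k - reflect w‖ ^ (-(2 * N)) =
      x k ^ ((s - 1) / s) * y k ^ (1 / s) := by
    intro k
    have hηk := hη k
    have hDk := hD k
    simp only [x, y]
    rw [Real.mul_rpow (by positivity) (by positivity), Real.mul_rpow (by positivity) (by positivity),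
      ← Real.rpow_mul hηk.le, ← Real.rpow_mul hηk.le, ← Real.rpow_mul hDk.le,
      ← Real.rpow_mul hDk.le, mul_mul_mul_comm, ← Real.rpow_add hηk, ← Real.rpow_add hDk]
    congr 2
    · field_simp; ring
    · field_simp; ring
  have hterm : ∀ k, ENNReal.ofReal (height (c k) ^ N * ‖c k - reflect w‖ ^ (-(2 * N))) * m k =
      ENNReal.ofReal (x k ^ ((s - 1) / s)) * (ENNReal.ofReal (y k ^ (1 / s)) * m k) := by
    intro k
    rw [hxy, ENNReal.ofReal_mul (Real.rpow_nonneg (hx k).le _), mul_assoc]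
  simp_rw [hterm]
  refine (tsum_mul_rpow_le hs _ _).trans ?_
  have hu : ∀ k, ENNReal.ofReal (x k ^ ((s - 1) / s)) ^ (s / (s - 1)) = ENNReal.ofReal (x k) := by
    intro k
    rw [ENNReal.ofReal_rpow_of_nonneg (Real.rpow_nonneg (hx k).le _) (by positivity),
      ← Real.rpow_mul (hx k).le, div_mul_div_cancel₀ hs0.ne', div_self hs1.ne', Real.rpow_one]
  have hv : ∀ k, (ENNReal.ofReal (y k ^ (1 / s)) * m k) ^ s = ENNReal.ofReal (y k) * m k ^ s := by
    intro k
    rw [ENNReal.mul_rpow_of_nonneg _ _ hs0.le,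
      ENNReal.ofReal_rpow_of_nonneg (Real.rpow_nonneg (hy k).le _) hs0.le,
      ← Real.rpow_mul (hy k).le, one_div_mul_cancel hs0.ne', Real.rpow_one]
  simp_rw [hu, hv]
  gcongr ?_ * _
  rw [Real.rpow_mul hw0.le, ← Real.mul_rpow hA.le (by positivity),
    ← ENNReal.ofReal_rpow_of_nonneg (by positivity) hs1.le]
  exact ENNReal.rpow_le_rpow (hA' w hw) hs1.le

theorem lintegral_kernel_rpow_le_tsum (hW : IsWhitney c r) {κ s : ℝ} (hκ : (n : ℝ) < n * κ)
    (hs : 1 < s) (μ : Measure (Pt n)) :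
    ∃ C : ℝ, 0 < C ∧
      ∫⁻ w, (∫⁻ z in upperHalf n, ENNReal.ofReal (kernel z w ^ κ) ∂μ) ^ s
          ∂(weightedVolume n (n * κ - n - 1)) ≤
        ENNReal.ofReal C * ∑' k, ENNReal.ofReal (height (c k) ^ (-(n * κ) * (s - 1))) *
          μ (cube (c k) (r k)) ^ s := by
  obtain ⟨F, hF, hF'⟩ := hW.lintegral_kernel_le_tsum κ μ
  obtain ⟨N, hN⟩ : ∃ N : ℝ, N = n * κ := ⟨_, rfl⟩
  simp only [← hN] at hF' hκ ⊢
  have hn : (0 : ℝ) ≤ n := Nat.cast_nonneg n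
  have hs0 : 0 < s := by linarith
  have hs1 : 0 < s - 1 := by linarith
  -- The bound δ < 2N - n makes the Hölder weights summable, and δ(s - 1) < N - n makes the
  -- remaining power of height w integrable at the boundary. Such δ > 0 exists because N > n.
  obtain ⟨δ, hδ, hδN, hδs⟩ : ∃ δ : ℝ, 0 < δ ∧ δ < 2 * N - n ∧ δ * (s - 1) < N - n := by
    refine ⟨min (N / 2) ((N - n) / (2 * (s - 1))), lt_min (by linarith)
      (div_pos (by linarith) (by linarith)), (min_le_left _ _).trans_lt (by linarith), ?_⟩
    refine (mul_le_mul_of_nonneg_right (min_le_right _ _) hs1.le).trans_lt ?_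
    rw [div_mul_eq_mul_div, mul_div_mul_right _ _ hs1.ne']
    linarith
  obtain ⟨A, hA, hA'⟩ := hW.rpow_tsum_center_le hs hδ hδN
  have hδ1 : 0 < δ * (s - 1) := by positivity
  -- The integral in w yields η_k^(-N - δ(s-1)), which cancels the δ-power left by Hölder and leaves
  -- exactly η_k^(-N(s-1)).
  obtain ⟨B, hB, hB'⟩ := lintegral_height_rpow_mul_norm_rpow_le n
    (β := N - n - 1 - δ * (s - 1)) (M := 2 * N) (by linarith) (by linarith)
  refine ⟨F ^ s * A * B, by positivity, ?_⟩
  have hm : Measurable (height : Pt n → ℝ) := continuous_height.measurable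
  have hmr : Measurable (reflect : Pt n → Pt n) := continuous_reflect.measurable
  rw [lintegral_weightedVolume]
  have hpt : ∀ w ∈ upperHalf n, ENNReal.ofReal (height w ^ (N - n - 1)) *
      (∫⁻ z in upperHalf n, ENNReal.ofReal (kernel z w ^ κ) ∂μ) ^ s ≤
      ENNReal.ofReal (F ^ s * A) * ∑' k,
        (ENNReal.ofReal (height (c k) ^ (N - N * (s - 1) + δ * (s - 1))) *
          μ (cube (c k) (r k)) ^ s) *
        ENNReal.ofReal (height w ^ (N - n - 1 - δ * (s - 1)) * ‖w - reflect (c k)‖ ^ (-(2 * N))) := by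
    intro w hw
    have hw0 : 0 < height w := hw
    calc _ ≤ ENNReal.ofReal (height w ^ (N - n - 1)) * (ENNReal.ofReal (F ^ s) *
          (ENNReal.ofReal (A * height w ^ (-δ * (s - 1))) *
          ∑' k, ENNReal.ofReal (height (c k) ^ (N - N * (s - 1) + δ * (s - 1)) *
            ‖c k - reflect w‖ ^ (-(2 * N))) * μ (cube (c k) (r k)) ^ s)) := by
          gcongr 1
          refine (ENNReal.rpow_le_rpow (hF' w hw) hs0.le).trans ?_
          rw [ENNReal.mul_rpow_of_nonneg _ _ hs0.le, ENNReal.ofReal_rpow_of_nonneg hF.le hs0.le]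
          gcongr 1
          exact hA' w hw _
      _ = _ := by
          rw [← mul_assoc, ← mul_assoc, ← ENNReal.ofReal_mul (by positivity),
            ← ENNReal.ofReal_mul (by positivity), ← ENNReal.tsum_mul_left, ← ENNReal.tsum_mul_left]
          refine tsum_congr fun k => ?_
          have hη : 0 < height (c k) := hW.center_mem k
          rw [norm_sub_reflect_comm w, mul_right_comm (ENNReal.ofReal _) (_ ^ s),
            ← mul_assoc, ← mul_assoc, ← ENNReal.ofReal_mul (by positivity),
            ← ENNReal.ofReal_mul (by positivity),
            ← mul_assoc (ENNReal.ofReal (F ^ s * A)), ← ENNReal.ofReal_mul (by positivity),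
            sub_eq_add_neg (N - n - 1), Real.rpow_add hw0, neg_mul]
          congr 2
          ring
  refine (setLIntegral_mono' (isOpen_upperHalf n).measurableSet hpt).trans ?_
  rw [lintegral_const_mul' _ _ ENNReal.ofReal_ne_top, lintegral_tsum (fun k => by fun_prop),
    ENNReal.ofReal_mul (q := B) (by positivity), mul_assoc]
  refine mul_le_mul_right ?_ _
  rw [← ENNReal.tsum_mul_left]
  refine ENNReal.tsum_le_tsum fun k => ?_
  rw [lintegral_const_mul _ (by fun_prop)]
  refine (mul_le_mul_right (hB' (c k) (hW.center_mem k)) _).trans (le_of_eq ?_)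
  have hη : 0 < height (c k) := hW.center_mem k
  rw [ENNReal.ofReal_mul hB.le, mul_right_comm, mul_left_comm, ← mul_assoc, ← mul_assoc, mul_assoc (ENNReal.ofReal B),
    ← ENNReal.ofReal_mul (by positivity), ← Real.rpow_add hη]
  congr 4
  ring

end IsWhitney

end HalfSpace

/-! ### The equivalence -/

theorem theorem7 (n : ℕ) (hn : 1 ≤ n) (c : ℕ → HalfSpace.Pt n) (r : ℕ → ℝ)
    (hW : HalfSpace.IsWhitney c r) (p q α : ℝ) (hp : 0 < p) (hpq : p < q) (hα : 0 < α)
    (μ : Measure (HalfSpace.Pt n)) :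
    (∫⁻ w, (∫⁻ z in HalfSpace.upperHalf n,
        ENNReal.ofReal (HalfSpace.kernel z w ^ (1 + α * q)) ∂μ) ^ (q / (q - p))
        ∂(HalfSpace.weightedVolume n (α * q * n - 1))) < ∞ ↔
    (∑' k, ENNReal.ofReal
        (HalfSpace.height (c k) ^ (-(α * q * n + n) * (p / (q - p)))) *
        μ (HalfSpace.cube (c k) (r k)) ^ (q / (q - p))) < ∞ := by
  have hq : 0 < q := hp.trans hpq
  have hqp : 0 < q - p := sub_pos.2 hpq
  have hn0 : (0 : ℝ) < n := by exact_mod_cast hn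
  have hαq : 0 < α * q := by positivity
  have hs : 1 < q / (q - p) := (one_lt_div hqp).2 (by linarith)
  have e1 : α * q * n - 1 = n * (1 + α * q) - n - 1 := by ring
  have e2 : -(α * q * n + n) * (p / (q - p)) = -(n * (1 + α * q)) * (q / (q - p) - 1) := by
    field_simp
    ring
  rw [e1, e2]
  obtain ⟨A, _, hA⟩ := hW.tsum_le_lintegral_kernel (κ := 1 + α * q) (by positivity)
    (by linarith : 0 ≤ q / (q - p)) μ
  -- The strict inequality n < n(1 + αq) needs n ≥ 1 as well as αq > 0.
  obtain ⟨B, _, hB⟩ := hW.lintegral_kernel_rpow_le_tsum (κ := 1 + α * q)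
    (lt_mul_of_one_lt_right hn0 (by linarith)) hs μ
  exact ⟨fun h => hA.trans_lt (ENNReal.mul_lt_top ENNReal.ofReal_lt_top h),
    fun h => hB.trans_lt (ENNReal.mul_lt_top ENNReal.ofReal_lt_top h)⟩
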